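/- Conventions. For an element $x$ of a semigroup $S$, $V(x)=\{y\in S: xyx=x,\ yxy=y\}$ is its set of inverses. An inverse subsemigroup $S^0$ of a regular semigroup $S$ is an \emph{inverse transversal} of $S$ if $|S^0\cap V(x)|=1$ for all $x\in S$; the unique element of $S^0\cap V(x)$ is written $x^0$, and $I(S)=\{xx^0:x\in S\}$. A \emph{left inverse semigroup} is a regular semigroup in which every $\mathcal R$-class contains exactly one idempotent. A \emph{left regular band} is a semigroup of idempotents satisfying $xyx=xy$; a \emph{semilattice transversal} of a band $I$ is a commutative subband $E$ with $|E\cap V(x)|=1$ for all $x\in I$, where $V(x)$ is formed in $I$. Let $S^0$ be an inverse semigroup with semilattice of idempotents $E^0$, and let $I$ be a left regular band with a semilattice transversal isomorphic to $E^0$; identify the two along a fixed isomorphism. For $e\in I$ let $L_e$ be the $\mathcal L$-class of $e$ in $I$. Suppose that there is a map $S^0\times I\to I$, $(x,e)\mapsto x\ast e$, with $$(xy)\ast e=x\ast(y\ast e),\qquad x\ast(ef)=(x\ast e)(x\ast f)\qquad (x,y\in S^0,\ e,f\in I)$$ and such that 1. $x\ast(yy^{-1})=(xy)(xy)^{-1}$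 for all $x,y\in S^0$; 2. $(xx^{-1})\ast e=(xx^{-1})e$ for all $x\in S^0$, $e\in I$. Let $W=\{(e,x)\in I\times S^0: e\in L_{xx^{-1}}\}$ with the product $(e,x)(g,y)=(e(x\ast g),xy)$. Then $W$ is a left inverse semigroup, $W^0=\{(xx^{-1},x):x\in S^0\}$ is an inverse transversal of $W$ isomorphic to $S^0$, and, with respect to this transversal, $I(W)$ is a subsemigroup of $W$ isomorphic to $I$. Conversely, if $S$ is a left inverse semigroup with an inverse transversal $S^0$, then there are a left regular band $I$ with a semilattice transversal isomorphic to the semilattice $E^0$ of idempotents of $S^0$, and a map $S^0\times I\to I$, with all the properties above, such that $S$ is isomorphic to the resulting semigroup $W$ by an isomorphism that maps $S^0$ onto $W^0$. -/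

import Mathlib

universe u v w

/-- `y` is an inverse of `x` in a semigroup, i.e. `y ∈ V(x)`. -/
def IsSemigroupInverse {S : Type*} [Mul S] (x y : S) : Prop :=
  x * y * x = x ∧ y * x * y = y

/-- A (von Neumann) regular semigroup. -/
def IsRegularSemigroup (S : Type*) [Mul S] : Prop :=
  ∀ x : S, ∃ y : S, x * y * x = x

/-- An inverse semigroup: every element has exactly one inverse. -/
def IsInverseSemigroup (S : Type*) [Mul S] : Prop :=
  ∀ x : S, ∃! y : S, IsSemigroupInverse x y

/-- Green's relation `L`, i.e. `S¹ a = S¹ b`. -/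
def GreenL {S : Type*} [Mul S] (a b : S) : Prop :=
  a = b ∨ ((∃ u, u * a = b) ∧ ∃ v, v * b = a)

/-- Green's relation `R`, i.e. `a S¹ = b S¹`. -/
def GreenR {S : Type*} [Mul S] (a b : S) : Prop :=
  a = b ∨ ((∃ u, a * u = b) ∧ ∃ v, b * v = a)

/-- A left inverse semigroup: a regular semigroup each of whose `R`-classes contains
exactly one idempotent. -/
def IsLeftInverseSemigroup (S : Type*) [Mul S] : Prop :=
  IsRegularSemigroup S ∧ ∀ a : S, ∃! e : S, IsIdempotentElem e ∧ GreenR a e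

/-- A left regular band: a band satisfying `x y x = x y`. -/
def IsLeftRegularBand (B : Type*) [Mul B] : Prop :=
  (∀ x : B, IsIdempotentElem x) ∧ ∀ x y : B, x * y * x = x * y

/-- `T` is an inverse transversal of the regular semigroup `S`: an inverse subsemigroup
with `|T ∩ V(x)| = 1` for all `x`. -/
structure IsInverseTransversal {S : Type*} [Semigroup S] (T : Subsemigroup S) : Prop where
  regular : IsRegularSemigroup S
  inverse : IsInverseSemigroup T
  existsUnique : ∀ x : S, ∃! y : S, y ∈ T ∧ IsSemigroupInverse x y

/-- `T` is a semilattice transversal of `B`: a subsemilattice (commutative subband)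
with `|T ∩ V(x)| = 1` for all `x`. -/
structure IsSemilatticeTransversal {B : Type*} [Semigroup B] (T : Subsemigroup B) : Prop where
  idem : ∀ x ∈ T, IsIdempotentElem x
  comm : ∀ x ∈ T, ∀ y ∈ T, x * y = y * x
  existsUnique : ∀ x : B, ∃! y : B, y ∈ T ∧ IsSemigroupInverse x y

/-- `I(S) = {x x⁰ : x ∈ S}`, where `x⁰` is the inverse of `x` in the transversal `T`. -/
def transversalI {S : Type*} [Semigroup S] (T : Subsemigroup S) : Set S :=
  {e | ∃ x y : S, y ∈ T ∧ IsSemigroupInverse x y ∧ e = x * y}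

namespace IsInverseSemigroup

/-- The unique inverse `x⁻¹` of `x`. -/
noncomputable def inv {S : Type u} [Semigroup S] (hS : IsInverseSemigroup S) (x : S) : S :=
  (hS x).choose

theorem inv_spec {S : Type u} [Semigroup S] (hS : IsInverseSemigroup S) (x : S) :
    IsSemigroupInverse x (hS.inv x) :=
  (hS x).choose_spec.1

theorem isIdempotentElem_mul {S : Type u} [Semigroup S] (hS : IsInverseSemigroup S) {e f : S}
    (he : e * e = e) (hf : f * f = f) : (e * f) * (e * f) = e * f := by
  obtain ⟨z, ⟨h1, h2⟩, hz⟩ := hS (e * f)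
  have hfz : f * z * e = z := by
    apply hz
    constructor
    · calc e * f * (f * z * e) * (e * f) = e * (f * f) * z * (e * e) * f := by
            simp only [mul_assoc]
        _ = e * f * z * (e * f) := by rw [he, hf]; simp only [mul_assoc]
        _ = e * f := h1
    · calc f * z * e * (e * f) * (f * z * e) = f * (z * ((e * e) * (f * f)) * z) * e := by
            simp only [mul_assoc]
        _ = f * z * e := by rw [he, hf, h2]
  have hzz : z * z = z := by
    calc z * z = (f * z * e) * (f * z * e) := by rw [hfz]
      _ = f * (z * (e * f) * z) * e := by simp only [mul_assoc]
      _ = z := by rw [h2, hfz]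
  have h3 : e * f = z := by
    obtain ⟨y, _, hy⟩ := hS z
    rw [hy (e * f) ⟨h2, h1⟩, hy z ⟨by rw [hzz, hzz], by rw [hzz, hzz]⟩]
  rw [h3, hzz]

/-- The semilattice `E(S)` of idempotents of an inverse semigroup `S`. -/
def idempotents {S : Type u} [Semigroup S] (hS : IsInverseSemigroup S) : Subsemigroup S where
  carrier := {e | IsIdempotentElem e}
  mul_mem' := fun he hf => hS.isIdempotentElem_mul he hf

/-- The idempotent `x x⁻¹`. -/
noncomputable def rangeIdem {S : Type u} [Semigroup S] (hS : IsInverseSemigroup S) (x : S) :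
    hS.idempotents :=
  ⟨x * hS.inv x, by
    change x * hS.inv x * (x * hS.inv x) = x * hS.inv x
    rw [← mul_assoc, (hS.inv_spec x).1]⟩

end IsInverseSemigroup

/-- An inverse semigroup `S₀` acting distributively on the left of a left regular band `I` that
has a semilattice transversal `E` isomorphic to `E(S₀)`, subject to (with `E(S₀)` identified
with `E`) `x ∗ (y y⁻¹) = (x y)(x y)⁻¹` and `(x x⁻¹) ∗ e = (x x⁻¹) e`. -/
structure DistributiveTransversalAction (S₀ : Type u) (I : Type v) [Semigroup S₀] [Semigroup I]
    (hS : IsInverseSemigroup S₀) where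
  leftRegular : IsLeftRegularBand I
  E : Subsemigroup I
  transversal : IsSemilatticeTransversal E
  iso : hS.idempotents ≃* E
  act : S₀ → I → I
  mul_act : ∀ (x y : S₀) (e : I), act (x * y) e = act x (act y e)
  act_mul : ∀ (x : S₀) (e f : I), act x (e * f) = act x e * act x f
  act_range : ∀ x y : S₀,
    act x (iso (hS.rangeIdem y) : I) = (iso (hS.rangeIdem (x * y)) : I)
  range_act : ∀ (x : S₀) (e : I), act (hS.rangeIdem x : S₀) e = (iso (hS.rangeIdem x) : I) * e

namespace DistributiveTransversalAction

/-- The image in `I` of the idempotent `x x⁻¹`. -/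
noncomputable def plus {S₀ : Type u} {I : Type v} [Semigroup S₀] [Semigroup I]
    {hS : IsInverseSemigroup S₀} (D : DistributiveTransversalAction S₀ I hS) (x : S₀) : I :=
  (D.iso (hS.rangeIdem x) : I)

/-- `W = {(e, x) ∈ I × S₀ : e ∈ L_{x x⁻¹}}`. -/
@[ext]
structure W {S₀ : Type u} {I : Type v} [Semigroup S₀] [Semigroup I]
    {hS : IsInverseSemigroup S₀} (D : DistributiveTransversalAction S₀ I hS) where
  fst : I
  snd : S₀
  mem : GreenL fst (D.plus snd)

theorem greenL_iff {I : Type v} [Semigroup I] (hI : IsLeftRegularBand I) (a b : I) :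
    GreenL a b ↔ a * b = a ∧ b * a = b := by
  constructor
  · rintro (rfl | ⟨⟨p, rfl⟩, ⟨q, hq⟩⟩)
    · exact ⟨hI.1 _, hI.1 _⟩
    · refine ⟨?_, ?_⟩
      · conv_lhs => lhs; rw [← hq]
        rw [mul_assoc, hI.1, hq]
      · rw [mul_assoc, hI.1]
  · rintro ⟨h1, h2⟩
    exact Or.inr ⟨⟨b, h2⟩, ⟨a, h1⟩⟩

theorem mul_mem {S₀ : Type u} {I : Type v} [Semigroup S₀] [Semigroup I]
    {hS : IsInverseSemigroup S₀} (D : DistributiveTransversalAction S₀ I hS) {e g : I} {x y : S₀}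
    (he : GreenL e (D.plus x)) (hg : GreenL g (D.plus y)) :
    GreenL (e * D.act x g) (D.plus (x * y)) := by
  rw [greenL_iff D.leftRegular] at he hg ⊢
  have h1 : D.act x g * D.plus (x * y) = D.act x g := by
    conv_rhs => rw [← hg.1, D.act_mul]
    rw [plus, plus, D.act_range]
  have h2 : D.plus (x * y) * D.act x g = D.plus (x * y) := by
    have h := D.act_range x y
    change D.act x (D.plus y) = D.plus (x * y) at h
    rw [← h, ← D.act_mul, hg.2]
  have h3 : D.plus x * D.plus (x * y) = D.plus (x * y) := by
    have h := D.range_act x (D.plus (x * y))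
    change _ = D.plus x * _ at h
    rw [← h, plus, D.act_range]
    have hx : ((hS.rangeIdem x : hS.idempotents) : S₀) * (x * y) = x * y := by
      change x * hS.inv x * (x * y) = x * y
      rw [← mul_assoc, (hS.inv_spec x).1]
    rw [hx]
  have h4 : D.plus (x * y) * e = D.plus (x * y) := by
    have hc : D.plus x * D.plus (x * y) = D.plus (x * y) * D.plus x :=
      D.transversal.comm _ (D.iso _).2 _ (D.iso _).2
    calc D.plus (x * y) * e = D.plus (x * y) * (D.plus x * e) := by
          rw [← mul_assoc, ← hc, h3]
      _ = D.plus (x * y) := by rw [he.2, ← hc, h3]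
  exact ⟨by rw [mul_assoc, h1], by rw [← mul_assoc, h4, h2]⟩

/-- The product `(e, x)(g, y) = (e (x ∗ g), x y)` on `W`. -/
noncomputable instance {S₀ : Type u} {I : Type v} [Semigroup S₀] [Semigroup I]
    {hS : IsInverseSemigroup S₀} (D : DistributiveTransversalAction S₀ I hS) :
    Semigroup D.W where
  mul p q := ⟨p.fst * D.act p.snd q.fst, p.snd * q.snd, D.mul_mem p.mem q.mem⟩
  mul_assoc p q r := by
    apply W.ext
    · change p.fst * D.act p.snd q.fst * D.act (p.snd * q.snd) r.fst =
        p.fst * D.act p.snd (q.fst * D.act q.snd r.fst)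
      rw [D.act_mul, D.mul_act, mul_assoc]
    · exact mul_assoc p.snd q.snd r.snd

/-- `W⁰ = {(x x⁻¹, x) : x ∈ S₀}`. -/
def base {S₀ : Type u} {I : Type v} [Semigroup S₀] [Semigroup I]
    {hS : IsInverseSemigroup S₀} (D : DistributiveTransversalAction S₀ I hS) : Set D.W :=
  {p | p.fst = D.plus p.snd}

end DistributiveTransversalAction

/-! Direct half. An idempotent `x` of `S₀` acts on `I` as left multiplication by `plus x`, and `e *
plus x = e` whenever `(e, x) ∈ W`. Hence the idempotents of `W` are the pairs with idempotent second
coordinate, and on them the first coordinate is multiplicative (`idem_mul_fst`). The rest is left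
regularity of `I`, commutativity of `E(S₀)`, and the fact that the inverse of `(e, x)` in `W⁰` is
`(x⁻¹x, x⁻¹)`. Also `I(W)` is the set of all idempotents of `W`.

Converse. Uniqueness of idempotents in `R`-classes makes `E(S)` a left regular band, and this is
taken as `I`. The transversal acts by `x ∗ e = x e x⁻¹`. The identity `x e x⁻¹ x = x e`
(`mul_idem_mul`) makes this action distributive and makes `(e, x) ↦ e x` a homomorphism; its inverse
is `s ↦ (s s⁰, (s⁰)⁻¹)`. -/

namespace IsInverseSemigroup

/-! ### Inverse semigroups: calculus of inverses and idempotents -/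

variable {S : Type u} [Semigroup S]

theorem inv_unique (hS : IsInverseSemigroup S) {x y : S} (h : IsSemigroupInverse x y) :
    y = hS.inv x :=
  (hS x).unique h (hS.inv_spec x)

theorem mul_inv_mul (hS : IsInverseSemigroup S) (x : S) : x * (hS.inv x * x) = x := by
  rw [← mul_assoc]; exact (hS.inv_spec x).1

theorem inv_inv (hS : IsInverseSemigroup S) (x : S) : hS.inv (hS.inv x) = x :=
  (hS.inv_unique (hS.inv_spec x).symm).symm

theorem inv_idem (hS : IsInverseSemigroup S) {e : S} (he : e * e = e) : hS.inv e = e :=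
  (hS.inv_unique ⟨by rw [he, he], by rw [he, he]⟩).symm

/-- Both `f * e` and `e * f` are inverses of the idempotent `e * f`. -/
theorem idem_comm (hS : IsInverseSemigroup S) {e f : S} (he : e * e = e) (hf : f * f = f) :
    e * f = f * e := by
  have h1 := hS.isIdempotentElem_mul he hf
  have h2 := hS.isIdempotentElem_mul hf he
  have h : IsSemigroupInverse (e * f) (f * e) := by
    constructor
    · calc e * f * (f * e) * (e * f) = e * (f * f) * (e * e) * f := by simp only [mul_assoc]
        _ = e * f * (e * f) := by rw [he, hf]; simp only [mul_assoc]
        _ = e * f := h1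
    · calc f * e * (e * f) * (f * e) = f * (e * e) * (f * f) * e := by simp only [mul_assoc]
        _ = f * e * (f * e) := by rw [he, hf]; simp only [mul_assoc]
        _ = f * e := h2
  rw [hS.inv_unique h, hS.inv_idem h1]

theorem mul_inv_idem (hS : IsInverseSemigroup S) (x : S) :
    x * hS.inv x * (x * hS.inv x) = x * hS.inv x := (hS.rangeIdem x).2

theorem inv_mul_idem (hS : IsInverseSemigroup S) (x : S) :
    hS.inv x * x * (hS.inv x * x) = hS.inv x * x := by
  rw [mul_assoc, hS.mul_inv_mul]

theorem inv_mul (hS : IsInverseSemigroup S) (x y : S) :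
    hS.inv (x * y) = hS.inv y * hS.inv x := by
  have hc := hS.idem_comm (hS.mul_inv_idem y) (hS.inv_mul_idem x)
  refine (hS.inv_unique ⟨?_, ?_⟩).symm
  · calc x * y * (hS.inv y * hS.inv x) * (x * y)
        = x * (y * hS.inv y * (hS.inv x * x)) * y := by simp only [mul_assoc]
      _ = (x * hS.inv x * x) * (y * hS.inv y * y) := by rw [hc]; simp only [mul_assoc]
      _ = x * y := by rw [(hS.inv_spec x).1, (hS.inv_spec y).1]
  · calc hS.inv y * hS.inv x * (x * y) * (hS.inv y * hS.inv x)
        = hS.inv y * (hS.inv x * x * (y * hS.inv y)) * hS.inv x := by simp only [mul_assoc]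
      _ = (hS.inv y * y * hS.inv y) * (hS.inv x * x * hS.inv x) := by
          rw [← hc]; simp only [mul_assoc]
      _ = hS.inv y * hS.inv x := by rw [(hS.inv_spec x).2, (hS.inv_spec y).2]

theorem rangeIdem_idem (hS : IsInverseSemigroup S) (f : hS.idempotents) :
    hS.rangeIdem (f : S) = f := by
  apply Subtype.ext
  change (f : S) * hS.inv f = f
  rw [hS.inv_idem f.2]
  exact f.2

theorem rangeIdem_mul_inv (hS : IsInverseSemigroup S) (x : S) :
    hS.rangeIdem (x * hS.inv x) = hS.rangeIdem x :=
  hS.rangeIdem_idem (hS.rangeIdem x)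

theorem of_mulEquiv {T : Type v} [Semigroup T] (hS : IsInverseSemigroup S) (φ : T ≃* S) :
    IsInverseSemigroup T := by
  intro x
  refine ⟨φ.symm (hS.inv (φ x)), ⟨?_, ?_⟩, fun y hy => ?_⟩
  · apply φ.injective; simpa using (hS.inv_spec (φ x)).1
  · apply φ.injective; simpa using (hS.inv_spec (φ x)).2
  · rw [φ.eq_symm_apply]
    exact hS.inv_unique ⟨by rw [← map_mul, ← map_mul, hy.1], by rw [← map_mul, ← map_mul, hy.2]⟩

end IsInverseSemigroup

/-! ### Green's relation `R` and idempotents -/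

theorem GreenR.symm {S : Type*} [Semigroup S] {a b : S} (h : GreenR a b) : GreenR b a := by
  rcases h with rfl | ⟨h1, h2⟩
  · exact Or.inl rfl
  · exact Or.inr ⟨h2, h1⟩

theorem GreenR.trans {S : Type*} [Semigroup S] {a b c : S} (h : GreenR a b) (h' : GreenR b c) :
    GreenR a c := by
  rcases h with rfl | ⟨⟨u, rfl⟩, v, hv⟩
  · exact h'
  · rcases h' with rfl | ⟨⟨s, rfl⟩, t, ht⟩
    · exact Or.inr ⟨⟨u, rfl⟩, v, hv⟩
    · exact Or.inr ⟨⟨u * s, by simp only [mul_assoc]⟩, t * v, by rw [← mul_assoc, ht, hv]⟩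

theorem GreenR.mul_eq_of_idem {S : Type*} [Semigroup S] {e f : S} (he : e * e = e)
    (h : GreenR e f) : e * f = f := by
  rcases h with rfl | ⟨⟨u, rfl⟩, -⟩
  · exact he
  · rw [← mul_assoc, he]

theorem IsLeftRegularBand.eq_of_mul_eq {B : Type*} [Semigroup B] (hB : IsLeftRegularBand B)
    {e f : B} (h1 : e * f = f) (h2 : f * e = e) : e = f := by
  have h := hB.2 e f
  rwa [h1, h2] at h

/-! ### The semigroup `W` of a distributive action -/

namespace DistributiveTransversalAction

variable {S₀ : Type u} {I : Type v} [Semigroup S₀] [Semigroup I] {hS : IsInverseSemigroup S₀}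
  (D : DistributiveTransversalAction S₀ I hS)

theorem fst_mul (p q : D.W) : (p * q).fst = p.fst * D.act p.snd q.fst := rfl

theorem snd_mul (p q : D.W) : (p * q).snd = p.snd * q.snd := rfl

theorem act_plus (x y : S₀) : D.act x (D.plus y) = D.plus (x * y) := D.act_range x y

theorem plus_mul_inv (x : S₀) : D.plus (x * hS.inv x) = D.plus x := by
  rw [plus, hS.rangeIdem_mul_inv, plus]

theorem act_mul_inv (x : S₀) (e : I) : D.act (x * hS.inv x) e = D.plus x * e := D.range_act x e

theorem act_idem {x : S₀} (hx : x * x = x) (e : I) : D.act x e = D.plus x * e := by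
  have h := D.act_mul_inv x e
  rwa [hS.inv_idem hx, hx] at h

theorem W.fst_mul_plus {D : DistributiveTransversalAction S₀ I hS} (p : D.W) :
    p.fst * D.plus p.snd = p.fst := ((greenL_iff D.leftRegular _ _).1 p.mem).1

theorem W.plus_mul_fst {D : DistributiveTransversalAction S₀ I hS} (p : D.W) :
    D.plus p.snd * p.fst = D.plus p.snd := ((greenL_iff D.leftRegular _ _).1 p.mem).2

/-- The element `(x x⁻¹, x)` of `W`. -/
noncomputable def ofBase (x : S₀) : D.W := ⟨D.plus x, x, Or.inl rfl⟩

theorem plus_mul_plus (x y : S₀) : D.plus x * D.plus (x * y) = D.plus (x * y) := by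
  rw [← D.act_mul_inv, D.act_plus, ← mul_assoc, (hS.inv_spec x).1]

theorem ofBase_mul (x y : S₀) : D.ofBase x * D.ofBase y = D.ofBase (x * y) := by
  apply W.ext
  · change D.plus x * D.act x (D.plus y) = D.plus (x * y)
    rw [D.act_plus, D.plus_mul_plus]
  · rfl

theorem mul_ofBase_inv (p : D.W) :
    (p * D.ofBase (hS.inv p.snd)).fst = p.fst := by
  change p.fst * D.act p.snd (D.plus (hS.inv p.snd)) = p.fst
  rw [D.act_plus, D.plus_mul_inv, p.fst_mul_plus]

theorem isSemigroupInverse_ofBase (p : D.W) :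
    IsSemigroupInverse p (D.ofBase (hS.inv p.snd)) := by
  constructor
  · apply W.ext
    · rw [fst_mul, mul_ofBase_inv, snd_mul]
      change p.fst * D.act (p.snd * hS.inv p.snd) p.fst = p.fst
      rw [D.act_mul_inv, p.plus_mul_fst, p.fst_mul_plus]
    · exact (hS.inv_spec p.snd).1
  · apply W.ext
    · change D.plus (hS.inv p.snd) * D.act (hS.inv p.snd) p.fst *
        D.act (hS.inv p.snd * p.snd) (D.plus (hS.inv p.snd)) = D.plus (hS.inv p.snd)
      -- Writing `plus x⁻¹` as `x⁻¹ ∗ plus x` puts all three factors under the action of `x⁻¹`,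
      -- where `plus x * e = plus x` collapses them.
      have h : D.plus (hS.inv p.snd) = D.act (hS.inv p.snd) (D.plus p.snd) := by
        rw [D.act_plus, ← D.plus_mul_inv (hS.inv p.snd), hS.inv_inv]
      rw [D.act_plus, (hS.inv_spec p.snd).2]
      rw [h, ← D.act_mul, ← D.act_mul, p.plus_mul_fst, D.leftRegular.1]
    · exact (hS.inv_spec p.snd).2

theorem idem_mul_fst {p : D.W} (hp : p.snd * p.snd = p.snd) (q : D.W) :
    (p * q).fst = p.fst * q.fst := by
  rw [fst_mul, D.act_idem hp, ← mul_assoc, p.fst_mul_plus]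

theorem isIdempotentElem_iff (p : D.W) : IsIdempotentElem p ↔ p.snd * p.snd = p.snd := by
  constructor
  · intro h
    exact congrArg W.snd h
  · intro h
    apply W.ext
    · rw [D.idem_mul_fst h, D.leftRegular.1]
    · exact h

theorem isRegularSemigroup_W : IsRegularSemigroup D.W := fun p =>
  ⟨_, (D.isSemigroupInverse_ofBase p).1⟩

theorem isLeftInverseSemigroup_W : IsLeftInverseSemigroup D.W := by
  refine ⟨D.isRegularSemigroup_W, fun p => ?_⟩
  refine ⟨p * D.ofBase (hS.inv p.snd), ⟨?_, ?_⟩, ?_⟩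
  · rw [isIdempotentElem_iff]
    exact hS.mul_inv_idem p.snd
  · exact Or.inr ⟨⟨_, rfl⟩, p, (D.isSemigroupInverse_ofBase p).1⟩
  · rintro q ⟨hq, hpq⟩
    set r := p * D.ofBase (hS.inv p.snd)
    have hri : IsIdempotentElem r := by
      rw [isIdempotentElem_iff]
      exact hS.mul_inv_idem p.snd
    have hpr : GreenR p r := Or.inr ⟨⟨_, rfl⟩, p, (D.isSemigroupInverse_ofBase p).1⟩
    -- `R`-related idempotents are left identities for each other; this forces equality in the left
    -- regular band `I` and, by commutativity, in `E(S₀)`.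
    have h1 := (hpq.symm.trans hpr).mul_eq_of_idem hq
    have h2 := (hpr.symm.trans hpq).mul_eq_of_idem hri
    rw [isIdempotentElem_iff] at hq hri
    apply W.ext
    · apply D.leftRegular.eq_of_mul_eq
      · rw [← D.idem_mul_fst hq, h1]
      · rw [← D.idem_mul_fst hri, h2]
    · calc q.snd = r.snd * q.snd := (congrArg W.snd h2).symm
        _ = q.snd * r.snd := hS.idem_comm hri hq
        _ = r.snd := congrArg W.snd h1

theorem eq_ofBase {p : D.W} (hp : p ∈ D.base) : p = D.ofBase p.snd := W.ext hp rfl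

/-- `W⁰` as a subsemigroup of `W`. -/
def baseSubsemigroup : Subsemigroup D.W where
  carrier := D.base
  mul_mem' {p q} hp hq := by
    rw [D.eq_ofBase hp, D.eq_ofBase hq, D.ofBase_mul]
    rfl

/-- The isomorphism `W⁰ ≃ S₀`. -/
noncomputable def baseEquiv : D.baseSubsemigroup ≃* S₀ where
  toFun p := p.1.snd
  invFun x := ⟨D.ofBase x, rfl⟩
  left_inv p := Subtype.ext (D.eq_ofBase p.2).symm
  right_inv _ := rfl
  map_mul' _ _ := rfl

theorem eq_ofBase_of_inverse {p q : D.W} (hq : q ∈ D.base) (h : IsSemigroupInverse p q) :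
    q = D.ofBase (hS.inv p.snd) := by
  rw [D.eq_ofBase hq]
  congr 1
  exact hS.inv_unique ⟨congrArg W.snd h.1, congrArg W.snd h.2⟩

theorem isInverseTransversal_base : IsInverseTransversal D.baseSubsemigroup where
  regular := D.isRegularSemigroup_W
  inverse := hS.of_mulEquiv D.baseEquiv
  existsUnique p :=
    ⟨D.ofBase (hS.inv p.snd), ⟨rfl, D.isSemigroupInverse_ofBase p⟩,
      fun _ hq => D.eq_ofBase_of_inverse hq.1 hq.2⟩

/-- The subsemigroup of idempotents of `W`. -/
def idempotentsW : Subsemigroup D.W where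
  carrier := {p | p.snd * p.snd = p.snd}
  mul_mem' hp hq := hS.isIdempotentElem_mul hp hq

theorem coe_idempotentsW : (D.idempotentsW : Set D.W) = transversalI D.baseSubsemigroup := by
  ext p
  constructor
  · intro hp
    change p.snd * p.snd = p.snd at hp
    refine ⟨p, _, rfl, D.isSemigroupInverse_ofBase p, ?_⟩
    apply W.ext
    · rw [D.mul_ofBase_inv]
    · change p.snd = p.snd * hS.inv p.snd
      rw [hS.inv_idem hp, hp]
  · rintro ⟨x, y, hy, hxy, rfl⟩
    rw [D.eq_ofBase_of_inverse hy hxy]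
    exact hS.mul_inv_idem x.snd

theorem plus_idem_injective {x y : S₀} (hx : x * x = x) (hy : y * y = y)
    (h : D.plus x = D.plus y) : x = y := by
  have h1 := D.iso.injective (Subtype.ext h)
  have hx' := hS.rangeIdem_idem ⟨x, hx⟩
  have hy' := hS.rangeIdem_idem ⟨y, hy⟩
  rw [hx', hy'] at h1
  exact congrArg Subtype.val h1

/-- Left regularity turns `e f e = e` into `e f = e`, so the inverse of `e` in the transversal is
`L`-related to `e`. -/
theorem exists_greenL_plus (e : I) : ∃ x : S₀, x * x = x ∧ GreenL e (D.plus x) := by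
  obtain ⟨f, ⟨hf, h1, h2⟩, -⟩ := D.transversal.existsUnique e
  have hfx : D.plus (D.iso.symm ⟨f, hf⟩ : S₀) = f := by
    rw [plus, hS.rangeIdem_idem, D.iso.apply_symm_apply]
  refine ⟨_, (D.iso.symm ⟨f, hf⟩).2, ?_⟩
  rw [hfx, greenL_iff D.leftRegular]
  exact ⟨by rw [← D.leftRegular.2, h1], by rw [← D.leftRegular.2, h2]⟩

/-- The first projection is an isomorphism from the idempotents of `W` onto `I`. -/
noncomputable def idempotentsWEquiv : D.idempotentsW ≃* I :=
  MulEquiv.ofBijective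
    ({ toFun := fun p => p.1.fst
       map_mul' := fun p q => D.idem_mul_fst p.2 q.1 } : D.idempotentsW →ₙ* I) <| by
    constructor
    · rintro ⟨p, hp⟩ ⟨q, hq⟩ (h : p.fst = q.fst)
      apply Subtype.ext
      refine W.ext h (D.plus_idem_injective hp hq ?_)
      -- Both `plus` elements are `L`-related to the common first coordinate, hence to each other;
      -- as they commute, they coincide.
      have h1 : D.plus p.snd * D.plus q.snd = D.plus p.snd := by
        conv_lhs => rw [← p.plus_mul_fst, h, mul_assoc, q.fst_mul_plus, ← h, p.plus_mul_fst]
      have h2 : D.plus q.snd * D.plus p.snd = D.plus q.snd := by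
        conv_lhs => rw [← q.plus_mul_fst, ← h, mul_assoc, p.fst_mul_plus, h, q.plus_mul_fst]
      have h3 : D.plus p.snd * D.plus q.snd = D.plus q.snd * D.plus p.snd :=
        D.transversal.comm _ (D.iso _).2 _ (D.iso _).2
      exact h1.symm.trans (h3.trans h2)
    · intro e
      obtain ⟨x, hx, he⟩ := D.exists_greenL_plus e
      exact ⟨⟨⟨e, x, he⟩, hx⟩, rfl⟩

end DistributiveTransversalAction

/-! ### The band of idempotents of a left inverse semigroup -/

namespace IsLeftInverseSemigroup

variable {S : Type w} [Semigroup S]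

/-- The form in which uniqueness of idempotents in `R`-classes is used from here on. -/
theorem idem_eq (h : IsLeftInverseSemigroup S) {e f : S} (he : e * e = e) (hf : f * f = f)
    (h1 : e * f = f) (h2 : f * e = e) : e = f :=
  (h.2 e).unique ⟨he, Or.inl rfl⟩ ⟨hf, Or.inr ⟨⟨f, h1⟩, e, h2⟩⟩

/-- For an inverse `z` of `e f`, the idempotent `g = f z e` is `R`-related to `g f`, so `g f = g`.
Then `e f g = e f`, and inserting `g` between two copies of `e f` gives the claim. -/
theorem isIdempotentElem_mul (h : IsLeftInverseSemigroup S) {e f : S} (he : e * e = e)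
    (hf : f * f = f) : e * f * (e * f) = e * f := by
  obtain ⟨y, hy⟩ := h.1 (e * f)
  obtain ⟨z, h1, h2⟩ : ∃ z, IsSemigroupInverse (e * f) z := by
    refine ⟨y * (e * f) * y, ?_, ?_⟩
    · calc e * f * (y * (e * f) * y) * (e * f)
          = (e * f * y * (e * f)) * y * (e * f) := by simp only [mul_assoc]
        _ = e * f := by rw [hy, hy]
    · calc y * (e * f) * y * (e * f) * (y * (e * f) * y)
          = y * ((e * f * y * (e * f)) * y * (e * f)) * y := by simp only [mul_assoc]
        _ = y * (e * f) * y := by rw [hy, hy]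
  have hh : f * z * e * (f * z * e) = f * z * e := by
    calc f * z * e * (f * z * e) = f * (z * (e * f) * z) * e := by simp only [mul_assoc]
      _ = f * z * e := by rw [h2]
  have hk : f * z * e * f = f * z * e := by
    refine (h.idem_eq hh ?_ ?_ ?_).symm
    · calc f * z * e * f * (f * z * e * f) = f * z * e * (f * f) * z * e * f := by
            simp only [mul_assoc]
        _ = (f * z * e * (f * z * e)) * f := by rw [hf]; simp only [mul_assoc]
        _ = f * z * e * f := by rw [hh]
    · rw [← mul_assoc, hh]
    · calc f * z * e * f * (f * z * e) = f * z * e * (f * f) * z * e := by simp only [mul_assoc]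
        _ = f * z * e * (f * z * e) := by rw [hf]; simp only [mul_assoc]
        _ = f * z * e := hh
  have hl : e * f * (f * z * e) = e * f := by
    rw [← hk]
    calc e * f * (f * z * e * f) = e * (f * f) * z * (e * f) := by simp only [mul_assoc]
      _ = e * f := by rw [hf, h1]
  calc e * f * (e * f) = e * f * (f * z * e) * (e * f) := by rw [hl]
    _ = e * (f * f) * z * (e * e) * f := by simp only [mul_assoc]
    _ = e * f * z * (e * f) := by rw [he, hf]; simp only [mul_assoc]
    _ = e * f := h1

theorem idem_mul_mul (h : IsLeftInverseSemigroup S) {e f : S} (he : e * e = e)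
    (hf : f * f = f) : e * f * e = e * f := by
  have hef := h.isIdempotentElem_mul he hf
  refine (h.idem_eq hef ?_ ?_ ?_).symm
  · calc e * f * e * (e * f * e) = e * f * (e * e) * f * e := by simp only [mul_assoc]
      _ = e * f * (e * f) * e := by rw [he]; simp only [mul_assoc]
      _ = e * f * e := by rw [hef]
  · rw [← mul_assoc, hef]
  · calc e * f * e * (e * f) = e * f * (e * e) * f := by simp only [mul_assoc]
      _ = e * f * (e * f) := by rw [he]; simp only [mul_assoc]
      _ = e * f := hef

/-- The band of idempotents of a left inverse semigroup. -/
def idempotents (h : IsLeftInverseSemigroup S) : Subsemigroup S where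
  carrier := {e | e * e = e}
  mul_mem' he hf := h.isIdempotentElem_mul he hf

theorem isLeftRegularBand_idempotents (h : IsLeftInverseSemigroup S) :
    IsLeftRegularBand h.idempotents :=
  ⟨fun e => Subtype.ext e.2, fun e f => Subtype.ext (h.idem_mul_mul e.2 f.2)⟩

/-- Since `e f` is an idempotent `R`-related to `e`, it equals `e`. Thus inverses of idempotents are
idempotent, and the transversal restricts to the band. -/
theorem idem_mul_inverse (h : IsLeftInverseSemigroup S) {e f : S} (he : e * e = e)
    (hef : IsSemigroupInverse e f) : e * f = e ∧ f * e = f ∧ f * f = f := by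
  have h1 : e * f = e := by
    refine (h.idem_eq he ?_ ?_ ?_).symm
    · rw [← mul_assoc, hef.1]
    · rw [← mul_assoc, he]
    · rw [hef.1]
  have h2 : f * e = f := by
    conv_rhs => rw [← hef.2, mul_assoc, h1]
  refine ⟨h1, h2, ?_⟩
  calc f * f = f * e * f := by rw [h2]
    _ = f := hef.2

/-- Write `x = x (y x)`: left regularity reduces `(y x) e (y x)` to `(y x) e`. -/
theorem mul_idem_mul (h : IsLeftInverseSemigroup S) {x y e : S} (hxy : IsSemigroupInverse x y)
    (he : e * e = e) : x * e * y * x = x * e := by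
  have hi : y * x * (y * x) = y * x := by rw [← mul_assoc, hxy.2]
  calc x * e * y * x = x * y * x * e * y * x := by rw [hxy.1]
    _ = x * (y * x * e * (y * x)) := by simp only [mul_assoc]
    _ = x * y * x * e := by rw [h.idem_mul_mul hi he]; simp only [mul_assoc]
    _ = x * e := by rw [hxy.1]

theorem conj_idem (h : IsLeftInverseSemigroup S) {x y e : S} (hxy : IsSemigroupInverse x y)
    (he : e * e = e) : x * e * y * (x * e * y) = x * e * y := by
  calc x * e * y * (x * e * y) = (x * e * y * x) * e * y := by simp only [mul_assoc]
    _ = x * (e * e) * y := by rw [h.mul_idem_mul hxy he]; simp only [mul_assoc]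
    _ = x * e * y := by rw [he]

/-! ### The conjugation action of a transversal and the isomorphism with `W` -/

variable {T : Subsemigroup S}

theorem coe_inv_spec (hT : IsInverseTransversal T) (x : T) :
    IsSemigroupInverse (x : S) (hT.inverse.inv x : S) :=
  ⟨congrArg Subtype.val (hT.inverse.inv_spec x).1, congrArg Subtype.val (hT.inverse.inv_spec x).2⟩

/-- The idempotents of `T` inside the band of idempotents of `S`. -/
def idempotentsOf (h : IsLeftInverseSemigroup S) (T : Subsemigroup S) :
    Subsemigroup h.idempotents where
  carrier := {e | (e : S) ∈ T}
  mul_mem' he hf := T.mul_mem he hf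

/-- The semilattice of idempotents of `T`, viewed inside the band of idempotents of `S`. -/
def idempotentsOfEquiv (h : IsLeftInverseSemigroup S) (hT : IsInverseTransversal T) :
    hT.inverse.idempotents ≃* h.idempotentsOf T where
  toFun e := ⟨⟨e.1.1, congrArg Subtype.val e.2⟩, e.1.2⟩
  invFun e := ⟨⟨e.1.1, e.2⟩, Subtype.ext e.1.2⟩
  left_inv _ := rfl
  right_inv _ := rfl
  map_mul' _ _ := rfl

theorem isSemilatticeTransversal_idempotentsOf (h : IsLeftInverseSemigroup S)
    (hT : IsInverseTransversal T) : IsSemilatticeTransversal (h.idempotentsOf T) where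
  idem e _ := Subtype.ext e.2
  comm e he f hf := by
    have hc := hT.inverse.idem_comm (e := ⟨e.1, he⟩) (f := ⟨f.1, hf⟩)
      (Subtype.ext e.2) (Subtype.ext f.2)
    exact Subtype.ext (congrArg Subtype.val hc :)
  existsUnique e := by
    obtain ⟨y, ⟨hy, hey⟩, hu⟩ := hT.existsUnique e.1
    refine ⟨⟨y, (h.idem_mul_inverse e.2 hey).2.2⟩, ⟨hy, Subtype.ext hey.1, Subtype.ext hey.2⟩, ?_⟩
    rintro f ⟨hf, hef⟩
    exact Subtype.ext (hu f.1 ⟨hf, congrArg Subtype.val hef.1, congrArg Subtype.val hef.2⟩)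

/-- The action of an inverse transversal on the band of idempotents by conjugation. -/
noncomputable def conjAction (h : IsLeftInverseSemigroup S) (hT : IsInverseTransversal T) :
    DistributiveTransversalAction T h.idempotents hT.inverse where
  leftRegular := h.isLeftRegularBand_idempotents
  E := h.idempotentsOf T
  transversal := h.isSemilatticeTransversal_idempotentsOf hT
  iso := h.idempotentsOfEquiv hT
  act x e := ⟨x * e * hT.inverse.inv x, h.conj_idem (coe_inv_spec hT x) e.2⟩
  mul_act x y e := by
    apply Subtype.ext
    change (x : S) * y * e * (hT.inverse.inv (x * y) : S) =
      x * (y * e * hT.inverse.inv y) * hT.inverse.inv x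
    rw [hT.inverse.inv_mul]
    change (x : S) * y * e * (hT.inverse.inv y * hT.inverse.inv x) = _
    simp only [mul_assoc]
  act_mul x e f := by
    apply Subtype.ext
    change (x : S) * (e * f) * hT.inverse.inv x =
      x * e * hT.inverse.inv x * (x * f * hT.inverse.inv x)
    have h1 := h.mul_idem_mul (coe_inv_spec hT x) e.2
    calc (x : S) * (e * f) * hT.inverse.inv x = x * e * f * hT.inverse.inv x := by
          simp only [mul_assoc]
      _ = x * e * hT.inverse.inv x * x * f * hT.inverse.inv x := by rw [h1]
      _ = _ := by simp only [mul_assoc]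
  act_range x y := by
    apply Subtype.ext
    change (x : S) * (y * hT.inverse.inv y) * hT.inverse.inv x =
      x * y * (hT.inverse.inv (x * y) : S)
    rw [hT.inverse.inv_mul]
    change _ = (x : S) * y * (hT.inverse.inv y * hT.inverse.inv x)
    simp only [mul_assoc]
  range_act x e := by
    apply Subtype.ext
    have hi : (x * hT.inverse.inv x) * (x * hT.inverse.inv x) = x * hT.inverse.inv x :=
      hT.inverse.mul_inv_idem x
    change (x : S) * hT.inverse.inv x * e * (hT.inverse.inv (x * hT.inverse.inv x) : S) =
      x * hT.inverse.inv x * e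
    rw [hT.inverse.inv_idem hi]
    exact h.idem_mul_mul (congrArg Subtype.val hi) e.2

theorem conjAction_mem_iff (h : IsLeftInverseSemigroup S) (hT : IsInverseTransversal T)
    (e : h.idempotents) (x : T) : GreenL e ((h.conjAction hT).plus x) ↔
      (e : S) * (x * hT.inverse.inv x) = e ∧
        (x : S) * hT.inverse.inv x * e = x * hT.inverse.inv x := by
  rw [DistributiveTransversalAction.greenL_iff h.isLeftRegularBand_idempotents,
    Subtype.ext_iff, Subtype.ext_iff]
  rfl

/-- The homomorphism `(e, x) ↦ e x`. -/
noncomputable def ofW (h : IsLeftInverseSemigroup S) (hT : IsInverseTransversal T) :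
    (h.conjAction hT).W →ₙ* S where
  toFun p := p.fst * p.snd
  map_mul' p q := by
    change (p.fst : S) * (p.snd * q.fst * hT.inverse.inv p.snd) * (p.snd * q.snd) =
      p.fst * p.snd * (q.fst * q.snd)
    have h1 := h.mul_idem_mul (coe_inv_spec hT p.snd) q.fst.2
    calc (p.fst : S) * (p.snd * q.fst * hT.inverse.inv p.snd) * (p.snd * q.snd)
        = p.fst * (p.snd * q.fst * hT.inverse.inv p.snd * p.snd) * q.snd := by
          simp only [mul_assoc]
      _ = _ := by rw [h1]; simp only [mul_assoc]

theorem ofW_apply (h : IsLeftInverseSemigroup S) (hT : IsInverseTransversal T)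
    (p : (h.conjAction hT).W) : h.ofW hT p = p.fst * p.snd := rfl

/-- This identifies `(e x)⁰` as `x⁻¹`, so `x` can be recovered from `e x`. -/
theorem isSemigroupInverse_ofW (h : IsLeftInverseSemigroup S) (hT : IsInverseTransversal T)
    (p : (h.conjAction hT).W) : IsSemigroupInverse (h.ofW hT p) (hT.inverse.inv p.snd : S) := by
  obtain ⟨h1, h2⟩ := (h.conjAction_mem_iff hT _ _).1 p.mem
  have hx := coe_inv_spec hT p.snd
  have he : (p.fst : S) * p.fst = p.fst := p.fst.2
  rw [ofW_apply]
  constructor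
  · calc (p.fst : S) * p.snd * hT.inverse.inv p.snd * (p.fst * p.snd)
        = p.fst * (p.snd * hT.inverse.inv p.snd) * p.fst * p.snd := by simp only [mul_assoc]
      _ = p.fst * p.snd := by rw [h1, he]
  · calc (hT.inverse.inv p.snd : S) * (p.fst * p.snd) * hT.inverse.inv p.snd
        = hT.inverse.inv p.snd * (p.fst * (p.snd * hT.inverse.inv p.snd)) := by
          simp only [mul_assoc]
      _ = hT.inverse.inv p.snd * p.snd * hT.inverse.inv p.snd * p.fst := by rw [h1, hx.2]
      _ = hT.inverse.inv p.snd * (p.snd * hT.inverse.inv p.snd * p.fst) := by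
          simp only [mul_assoc]
      _ = hT.inverse.inv p.snd := by rw [h2, ← mul_assoc, hx.2]

theorem ofW_bijective (h : IsLeftInverseSemigroup S) (hT : IsInverseTransversal T) :
    Function.Bijective (h.ofW hT) := by
  constructor
  · intro p q hpq
    have hp := h.isSemigroupInverse_ofW hT p
    have hq := h.isSemigroupInverse_ofW hT q
    rw [← hpq] at hq
    have hinv : hT.inverse.inv p.snd = hT.inverse.inv q.snd :=
      Subtype.ext ((hT.existsUnique _).unique ⟨Subtype.prop _, hp⟩ ⟨Subtype.prop _, hq⟩)
    have hsnd : p.snd = q.snd := by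
      rw [← hT.inverse.inv_inv p.snd, hinv, hT.inverse.inv_inv]
    refine DistributiveTransversalAction.W.ext (Subtype.ext ?_) hsnd
    -- The band component is recovered as `e = e x x⁻¹ = (e x) x⁻¹`.
    rw [← ((h.conjAction_mem_iff hT _ _).1 p.mem).1, ← ((h.conjAction_mem_iff hT _ _).1 q.mem).1,
      ← mul_assoc, ← mul_assoc, ← ofW_apply, ← ofW_apply, hpq, hinv]
  · intro s
    obtain ⟨y, ⟨hy, hsy⟩, -⟩ := hT.existsUnique s
    have hz := coe_inv_spec hT ⟨y, hy⟩
    set z : T := hT.inverse.inv ⟨y, hy⟩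
    have hzi : hT.inverse.inv z = ⟨y, hy⟩ := hT.inverse.inv_inv _
    change IsSemigroupInverse y (z : S) at hz
    -- With `y = s⁰` and `z = y⁻¹`, both sides are idempotents in the `R`-class of `y`.
    have hys : y * s = y * z := by
      apply h.idem_eq
      · rw [← mul_assoc, hsy.2]
      · rw [← mul_assoc, hz.1]
      · rw [← mul_assoc, hsy.2]
      · rw [← mul_assoc, hz.1]
    -- The preimage of `s` is `(s s⁰, (s⁰)⁻¹)`.
    refine ⟨⟨⟨s * y, ?_⟩, z, ?_⟩, ?_⟩
    · change s * y * (s * y) = s * y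
      rw [← mul_assoc, hsy.1]
    · rw [conjAction_mem_iff, hzi]
      constructor
      · calc s * y * (z * y) = s * (y * z * y) := by simp only [mul_assoc]
          _ = s * y := by rw [hz.1]
      · calc (z : S) * y * (s * y) = z * (y * s * y) := by simp only [mul_assoc]
          _ = z * y := by rw [hsy.2]
    · change s * y * z = s
      rw [mul_assoc, ← hys, ← mul_assoc, hsy.1]

/-- The isomorphism from `S` onto the semigroup `W` of the conjugation action. -/
noncomputable def equivW (h : IsLeftInverseSemigroup S) (hT : IsInverseTransversal T) :
    S ≃* (h.conjAction hT).W :=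
  (MulEquiv.ofBijective (h.ofW hT) (h.ofW_bijective hT)).symm

theorem equivW_coe (h : IsLeftInverseSemigroup S) (hT : IsInverseTransversal T) (x : T) :
    h.equivW hT x = (h.conjAction hT).ofBase x := by
  rw [equivW, MulEquiv.symm_apply_eq]
  exact (coe_inv_spec hT x).1.symm

theorem equivW_image (h : IsLeftInverseSemigroup S) (hT : IsInverseTransversal T) :
    h.equivW hT '' (T : Set S) = (h.conjAction hT).base := by
  ext p
  constructor
  · rintro ⟨x, hx, rfl⟩
    rw [h.equivW_coe hT ⟨x, hx⟩]
    rfl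
  · intro hp
    exact ⟨p.snd, p.snd.2, by
      rw [h.equivW_coe hT, ← DistributiveTransversalAction.eq_ofBase _ hp]⟩

end IsLeftInverseSemigroup

theorem mainTheorem9 :
    (∀ (S₀ : Type u) (I : Type v) [Semigroup S₀] [Semigroup I] (hS : IsInverseSemigroup S₀)
      (D : DistributiveTransversalAction S₀ I hS),
      IsLeftInverseSemigroup D.W ∧
      ∃ T : Subsemigroup D.W, (T : Set D.W) = D.base ∧ IsInverseTransversal T ∧
        Nonempty (T ≃* S₀) ∧
        ∃ J : Subsemigroup D.W, (J : Set D.W) = transversalI T ∧ Nonempty (J ≃* I)) ∧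
    (∀ (S : Type w) [Semigroup S] (T : Subsemigroup S) (hT : IsInverseTransversal T),
      IsLeftInverseSemigroup S →
      ∃ (I : Type w) (_ : Semigroup I) (D : DistributiveTransversalAction T I hT.inverse)
        (θ : S ≃* D.W), θ '' (T : Set S) = D.base) :=

  ⟨fun _ _ _ _ _ D =>
    ⟨D.isLeftInverseSemigroup_W, D.baseSubsemigroup, rfl, D.isInverseTransversal_base,
      ⟨D.baseEquiv⟩, D.idempotentsW, D.coe_idempotentsW, ⟨D.idempotentsWEquiv⟩⟩,
    fun _ _ _ hT h =>
      ⟨h.idempotents, inferInstance, h.conjAction hT, h.equivW hT, h.equivW_image hT⟩⟩
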